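/- Let $K$ be a field, let $n \ge 7$, and let $a,b \in [n]=\{1,\dots,n\}$ satisfy $a-b \equiv 2$ or $a-b\equiv -2 \pmod n$. For an integer $c$ let $\overline{c}\in[n]$ be its residue modulo $n$. Let $\mathcal{A}_n$ be the anticycle on $[n]$, that is, the complement of the cycle with edges $\{i,\overline{i+1}\}$, $1\le i\le n$. Let $H$ be the graph on $[n]$ obtained from $\mathcal{A}_n$ by removing the edges $\{a,b\}$ and $\{\overline{a+1},\overline{b+1}\}$ and adding the edge $\{\overline{a+1},a\}$, and let $$I_H = (x_i x_j \mid \{i,j\}\in E(H)) \subset K[x_1,\dots,x_n]$$ be its edge ideal. Then $I_H^2$ and $I_H^3$ have linear quotients. Here a monomial ideal $I$ is said to have linear quotients if it is principal or its minimal monomial generators can be ordered as $M_1,\dots,M_r$ in such a way that for every $i\in\{2,\dots,r\}$ the colon ideal $(M_1,\dots,M_{i-1}):M_i$ is generated by a subset of the variables $\{x_1,\dots,x_n\}$. -/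

import Mathlib

namespace LinearQuotients

/-- The anticycle of order `n`: the complement of the cycle graph on `n` vertices.
The vertex labels `1, …, n` are represented by `Fin n` (the label `i + 1` is `i : Fin n`), and
addition in `Fin n` is modulo `n`. -/
def anticycle (n : ℕ) : SimpleGraph (Fin n) :=
  (SimpleGraph.cycleGraph n)ᶜ

/-- The graph obtained from the anticycle of order `n` by removing the edges `{a, b}` and
`{a + 1, b + 1}` and adding the edge `{a + 1, a}`, where `+ 1` is taken modulo `n`. -/
def modifiedAnticycle (n : ℕ) [NeZero n] (a b : Fin n) : SimpleGraph (Fin n) :=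
  (anticycle n).deleteEdges {s(a, b), s(a + 1, b + 1)} ⊔ SimpleGraph.edge (a + 1) a

section Ideals

variable {σ : Type*} (K : Type*) [Field K]

/-- The edge ideal of a graph: generated by the `x_i x_j` with `{i, j}` an edge. -/
noncomputable def edgeIdeal (G : SimpleGraph σ) : Ideal (MvPolynomial σ K) :=
  Ideal.span {f | ∃ i j, G.Adj i j ∧ f = MvPolynomial.X i * MvPolynomial.X j}

variable {K}

/-- A monomial ideal: an ideal generated by monomials. -/
def IsMonomialIdeal (I : Ideal (MvPolynomial σ K)) : Prop :=
  ∃ S : Set (σ →₀ ℕ), I = Ideal.span ((fun m => MvPolynomial.monomial m (1 : K)) '' S)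

/-- The exponents of the minimal monomial generators of a monomial ideal: the monomials in the
ideal that are minimal for divisibility. -/
def minimalGenerators (I : Ideal (MvPolynomial σ K)) : Set (σ →₀ ℕ) :=
  {m | Minimal (fun m' => MvPolynomial.monomial m' (1 : K) ∈ I) m}

/-- `M 0, …, M (r - 1)` is a linear quotient ordering of `I`: it lists the minimal monomial
generators of `I` without repetition, and each colon ideal
`(M 0, …, M (i - 1)) : M i` with `i > 0` is generated by a set of variables. -/
def IsLinearQuotientOrdering (I : Ideal (MvPolynomial σ K)) {r : ℕ} (M : Fin r → (σ →₀ ℕ)) :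
    Prop :=
  Function.Injective M ∧ Set.range M = minimalGenerators I ∧
    ∀ i : Fin r, 0 < (i : ℕ) → ∃ A : Set σ,
      (Ideal.span ((fun j => MvPolynomial.monomial (M j) (1 : K)) '' {j | j < i})).colon
          {MvPolynomial.monomial (M i) (1 : K)} =
        Ideal.span ((MvPolynomial.X : σ → MvPolynomial σ K) '' A)

/-- A monomial ideal has linear quotients if it is principal or if it has a linear quotient
ordering. -/
def HasLinearQuotients (I : Ideal (MvPolynomial σ K)) : Prop :=
  IsMonomialIdeal I ∧
    (Submodule.IsPrincipal I ∨
      ∃ (r : ℕ) (M : Fin r → (σ →₀ ℕ)), IsLinearQuotientOrdering I M)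

end Ideals

end LinearQuotients

/-!
The complement of the modified anticycle is, up to relabelling, an `n`-cycle `0, 1, …, n - 1`
together with the single chord `{3, 5}` (`exists_isChordedCycleLabelling`): exchanging the
positions of two consecutive vertices turns the removed and added edges into this chord. The proof
below gives linear quotients for the `k`-th power for every `k ≥ 2`.

*Generators.* A monomial of degree `2 k` is a product of `k` edges exactly when its exponents sum to
at most `k` over every clique `{i, i + 1}`, `{n - 1, 0}`, `{3, 4, 5}` of the complement
(`IsChordedCycleLabelling.mem_edgeProducts`). Necessity holds since an edge meets a clique at most
once. For sufficiency, list the `2 k` factors in cyclic order and pair the first with the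
`(k + 1)`-st: two factors in a common clique would force `k + 1` factors into that clique, and
removing the pair lowers every tight clique sum (`IsCliqueBounded.exists_pair`).

*Order.* In descending lexicographic order of the exponents the exchange argument fails only at the
monomials `(x₀ x₂) ^ c * (x₁ x_{n - 1}) ^ (k - c)`: at position `0` both cliques can be tight with
their other members later in the order. The remedy is to put all generators supported on
`{n - 1, 0, 1, 2}` last, in ascending lexicographic order, and the other generators before them in
descending lexicographic order (`Precedes`). For `n ≥ 7` the chord lies within the remaining
positions `3, …, n - 2`, so that it does not interfere.

*Exchange.* If `β` precedes `α`, then some `x_s` with `α s < β s` and some `x_r` dividing `x ^ α`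
are such that `x_s x ^ α / x_r` is a generator preceding `α` (`hasExchange_of_precedes`). For
equigenerated monomial ideals this is the linear quotient property (`hasLinearQuotients_of_key`). -/

namespace LinearQuotients

/-! ### Exchanges between clique-bounded exponent vectors -/

/-- The exponent vector `α`, indexed by the positions `0, …, n - 1`, has degree `2 * k` and sums to
at most `k` over each clique `{i, i + 1}`, `{0, n - 1}` and `{3, 4, 5}` of the `n`-cycle with chord
`{3, 5}`. Values of `α` at positions `≥ n` are irrelevant when `7 ≤ n`. -/
structure IsCliqueBounded (n k : ℕ) (α : ℕ → ℕ) : Prop where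
  sum : ∑ i ∈ Finset.range n, α i = 2 * k
  pair : ∀ i, i + 1 < n → α i + α (i + 1) ≤ k
  wrap : α 0 + α (n - 1) ≤ k
  triple : α 3 + α 4 + α 5 ≤ k

/-- On the positions below `n`, the vector `α'` arises from `α` by adding `1` at `s` and subtracting
`1` at `r`. -/
structure IsExchange (n : ℕ) (α α' : ℕ → ℕ) (s r : ℕ) : Prop where
  ne : s ≠ r
  add : α' s = α s + 1
  sub : α' r + 1 = α r
  same : ∀ i < n, i ≠ s → i ≠ r → α' i = α i

/-- The part of the degree carried by the positions `3, …, n - 2`, that is, outside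
`{n - 1, 0, 1, 2}`. -/
def midSum (n : ℕ) (α : ℕ → ℕ) : ℕ := ∑ i ∈ Finset.Ico 3 (n - 1), α i

/-- `α` is lexicographically smaller than `β` on the positions `0, …, n - 1`. -/
def LexLT (n : ℕ) (α β : ℕ → ℕ) : Prop := ∃ t < n, (∀ i < t, α i = β i) ∧ α t < β t

/-- The generator order: vectors with a position in `3, …, n - 2` come first, in descending
lexicographic order, followed by those supported on `{n - 1, 0, 1, 2}` in ascending
lexicographic order. -/
def Precedes (n : ℕ) (β α : ℕ → ℕ) : Prop :=
  (midSum n β ≠ 0 ∧ midSum n α = 0) ∨ (midSum n β ≠ 0 ∧ midSum n α ≠ 0 ∧ LexLT n α β) ∨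
    (midSum n β = 0 ∧ midSum n α = 0 ∧ LexLT n β α)

section Exchange

variable {n k s r : ℕ} {α β α' : ℕ → ℕ}

theorem IsExchange.sum_eq (h : IsExchange n α α' s r) {T : Finset ℕ} (hT : T ⊆ Finset.range n) :
    ∑ i ∈ T, α' i + (if r ∈ T then 1 else 0) = ∑ i ∈ T, α i + (if s ∈ T then 1 else 0) := by
  rw [← Finset.sum_ite_eq' T r (fun _ => 1), ← Finset.sum_ite_eq' T s (fun _ => 1),
    ← Finset.sum_add_distrib, ← Finset.sum_add_distrib]
  refine Finset.sum_congr rfl fun i hi => ?_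
  have hin := Finset.mem_range.1 (hT hi)
  have h1 := h.ne
  have h2 := h.add
  have h3 := h.sub
  by_cases his : i = s
  · subst his; simp [h1, h2]
  · by_cases hir : i = r
    · subst hir; simp [his, h3]
    · simp [his, hir, h.same i hin his hir]

/-- An exchange preserves clique-boundedness if it removes a factor from each tight clique to which
it adds one. -/
theorem IsExchange.isCliqueBounded (h : IsExchange n α α' s r) (hα : IsCliqueBounded n k α)
    (hn : 7 ≤ n) (hs : s < n) (hr : r < n)
    (hpair : ∀ i, i + 1 < n → (s = i ∨ s = i + 1) → r ≠ i → r ≠ i + 1 → α i + α (i + 1) < k)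
    (hwrap : (s = 0 ∨ s = n - 1) → r ≠ 0 → r ≠ n - 1 → α 0 + α (n - 1) < k)
    (htriple : (s = 3 ∨ s = 4 ∨ s = 5) → r ≠ 3 → r ≠ 4 → r ≠ 5 → α 3 + α 4 + α 5 < k) :
    IsCliqueBounded n k α' := by
  have hne := h.ne
  have hbound : ∀ T : Finset ℕ, T ⊆ Finset.range n → ∑ i ∈ T, α i ≤ k →
      (s ∈ T → r ∉ T → ∑ i ∈ T, α i < k) → ∑ i ∈ T, α' i ≤ k := by
    intro T hT hk hst
    have := h.sum_eq hT
    by_cases h1 : s ∈ T <;> by_cases h2 : r ∈ T <;> simp [h1, h2] at this hst <;> omega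
  refine ⟨?_, fun i hi => ?_, ?_, ?_⟩
  · have := h.sum_eq (Finset.Subset.refl _)
    rw [if_pos (Finset.mem_range.2 hr), if_pos (Finset.mem_range.2 hs), hα.sum] at this
    omega
  · have := hbound {i, i + 1} (by intro j; simp; omega)
    rw [Finset.sum_pair (by omega), Finset.sum_pair (by omega)] at this
    refine this (hα.pair i hi) fun h1 h2 => ?_
    simp at h1 h2
    exact hpair i hi h1 h2.1 h2.2
  · have := hbound {0, n - 1} (by intro j; simp; omega)
    rw [Finset.sum_pair (by omega), Finset.sum_pair (by omega)] at this
    refine this hα.wrap fun h1 h2 => ?_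
    simp at h1 h2
    exact hwrap h1 h2.1 h2.2
  · have := hbound {3, 4, 5} (by intro j; simp; omega)
    have h3 : ∀ f : ℕ → ℕ, ∑ i ∈ ({3, 4, 5} : Finset ℕ), f i = f 3 + f 4 + f 5 := fun f => by
      simp [add_assoc]
    rw [h3, h3] at this
    refine this hα.triple fun h1 h2 => ?_
    simp at h1 h2
    exact htriple h1 h2.1 h2.2.1 h2.2.2

theorem IsExchange.midSum_eq (h : IsExchange n α α' s r) :
    midSum n α' + (if r ∈ Finset.Ico 3 (n - 1) then 1 else 0) =
      midSum n α + (if s ∈ Finset.Ico 3 (n - 1) then 1 else 0) :=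
  h.sum_eq (by intro j; simp; omega)

theorem IsExchange.lexLT_of_lt (h : IsExchange n α α' s r) (hs : s < n) (hsr : s < r) :
    LexLT n α α' :=
  ⟨s, hs, fun i hi => (h.same i (by omega) (by omega) (by omega)).symm, by have := h.add; omega⟩

theorem IsExchange.lexLT_of_gt (h : IsExchange n α α' s r) (hr : r < n) (hsr : r < s) :
    LexLT n α' α :=
  ⟨r, hr, fun i hi => h.same i (by omega) (by omega) (by omega), by have := h.sub; omega⟩

theorem IsCliqueBounded.sum_eq (hα : IsCliqueBounded n k α) (hn : 7 ≤ n) :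
    α 0 + α 1 + α 2 + midSum n α + α (n - 1) = 2 * k := by
  obtain ⟨m, rfl⟩ : ∃ m, n = m + 1 := ⟨n - 1, by omega⟩
  have h := hα.sum
  rw [Finset.sum_range_succ, Finset.range_eq_Ico,
    ← Finset.sum_Ico_consecutive α (Nat.zero_le 3) (by omega : 3 ≤ m)] at h
  simp [Finset.sum_Ico_eq_sum_range, Finset.sum_range_succ] at h
  simp [midSum, Finset.sum_Ico_eq_sum_range]
  omega

theorem le_midSum (α : ℕ → ℕ) {i : ℕ} (h3 : 3 ≤ i) (hi : i < n - 1) : α i ≤ midSum n α :=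
  Finset.single_le_sum (f := α) (fun _ _ => Nat.zero_le _) (Finset.mem_Ico.2 ⟨h3, hi⟩)

theorem add_le_midSum (α : ℕ → ℕ) {i j : ℕ} (h3 : 3 ≤ i) (hij : i < j) (hj : j < n - 1) :
    α i + α j ≤ midSum n α := by
  rw [← Finset.sum_pair (by omega : i ≠ j)]
  exact Finset.sum_le_sum_of_subset (by intro l; simp; omega)

theorem add_add_le_midSum (α : ℕ → ℕ) (hn : 7 ≤ n) : α 3 + α 4 + α 5 ≤ midSum n α := by
  have : ∑ i ∈ ({3, 4, 5} : Finset ℕ), α i ≤ midSum n α :=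
    Finset.sum_le_sum_of_subset (by intro l; simp; omega)
  simpa [add_assoc] using this

theorem exists_of_midSum_ne_zero (h : midSum n β ≠ 0) : ∃ i, 3 ≤ i ∧ i < n - 1 ∧ 0 < β i := by
  obtain ⟨i, hi, h0⟩ := Finset.exists_ne_zero_of_sum_ne_zero h
  rw [Finset.mem_Ico] at hi
  exact ⟨i, hi.1, hi.2, by omega⟩

/-- The vector `α` can be moved by one exchange towards `β`, staying clique-bounded and going to an
earlier place in the generator order. The result is quantified over all `α'` because it is
determined only at the positions below `n`. -/
def HasExchange (n k : ℕ) (α β : ℕ → ℕ) : Prop :=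
  ∃ s < n, ∃ r < n, s ≠ r ∧ 0 < α r ∧ α s < β s ∧
    ∀ α', IsExchange n α α' s r → IsCliqueBounded n k α' ∧ Precedes n α' α

/-- Exchange from a vector supported on `{n - 1, 0, 1, 2}` towards one that is not: any factor at a
position in `3, …, n - 2` can be added, the removed factor being prescribed only next to a tight
clique `{2, 3}` or `{n - 2, n - 1}`. -/
theorem hasExchange_of_midSum_eq_zero (hn : 7 ≤ n) (hk : 0 < k) (hα : IsCliqueBounded n k α)
    (hα0 : midSum n α = 0) (hβ0 : midSum n β ≠ 0) : HasExchange n k α β := by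
  obtain ⟨s, hs3, hsn, hβs⟩ := exists_of_midSum_ne_zero hβ0
  have hsum := hα.sum_eq hn
  have hz : ∀ i, 3 ≤ i → i < n - 1 → α i = 0 := fun i h3 hi => by
    have := le_midSum α h3 hi; omega
  have hs0 := hz s hs3 hsn
  obtain ⟨r, hr, hr0, h2, h3⟩ : ∃ r, (r < 3 ∨ r = n - 1) ∧ 0 < α r ∧
      (s = 3 → α 2 = k → r = 2) ∧ (s + 1 = n - 1 → α (n - 1) = k → r = n - 1) := by
    by_cases h2 : s = 3 ∧ α 2 = k
    · exact ⟨2, by omega, by omega, by omega, by omega⟩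
    by_cases h3 : s + 1 = n - 1 ∧ α (n - 1) = k
    · exact ⟨n - 1, by omega, by omega, by omega, by omega⟩
    have : 0 < α 0 ∨ 0 < α 1 ∨ 0 < α 2 ∨ 0 < α (n - 1) := by omega
    rcases this with h | h | h | h
    · exact ⟨0, by omega, h, by omega, by omega⟩
    · exact ⟨1, by omega, h, by omega, by omega⟩
    · exact ⟨2, by omega, h, by omega, by omega⟩
    · exact ⟨n - 1, by omega, h, by omega, by omega⟩
  refine ⟨s, by omega, r, by omega, by omega, hr0, by omega, fun α' h => ⟨?_, Or.inl ⟨?_, hα0⟩⟩⟩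
  · refine h.isCliqueBounded hα hn (by omega) (by omega) ?_ (by omega) ?_
    · rintro i hi (rfl | rfl) hri hri'
      · by_cases hi' : s + 1 = n - 1
        · have := hα.pair s hi
          have : α (s + 1) = α (n - 1) := by rw [hi']
          omega
        · have := hz (s + 1) (by omega) (by omega)
          omega
      · by_cases hi' : i = 2
        · subst hi'
          have := hα.pair 2 hi
          omega
        · have := hz i (by omega) (by omega)
          omega
    · have := hz 3 le_rfl (by omega)
      have := hz 4 (by omega) (by omega)
      have := hz 5 (by omega) (by omega)
      omega
  · have := h.midSum_eq
    rw [if_pos (Finset.mem_Ico.2 ⟨hs3, hsn⟩)] at this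
    split_ifs at this <;> simp at * <;> omega

/-- Exchange between two vectors supported on `{n - 1, 0, 1, 2}`. For such vectors both
`{n - 1, 0}` and `{1, 2}` are tight, so that they are determined by their values at `0` and `2`, and
the exchanges take place within these two cliques. -/
theorem hasExchange_of_midSum_eq_zero_of_midSum_eq_zero (hn : 7 ≤ n)
    (hα : IsCliqueBounded n k α) (hβ : IsCliqueBounded n k β)
    (hα0 : midSum n α = 0) (hβ0 : midSum n β = 0) (hlex : LexLT n β α) : HasExchange n k α β := by
  have hsα := hα.sum_eq hn
  have hsβ := hβ.sum_eq hn
  have hzα : ∀ i, 3 ≤ i → i < n - 1 → α i = 0 := fun i h3 hi => by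
    have := le_midSum α h3 hi; omega
  have h1 := hα.wrap
  have h2 := hβ.wrap
  have h3 := hα.pair 1 (by omega)
  have h4 := hβ.pair 1 (by omega)
  have h5 := hα.pair 0 (by omega)
  norm_num at h3 h4 h5
  have hn1 : n - 2 + 1 = n - 1 := by omega
  obtain ⟨t, htn, heq, hlt⟩ := hlex
  rcases Nat.lt_or_ge t 3 with ht | ht
  · interval_cases t
    · refine ⟨n - 1, by omega, 0, by omega, by omega, by omega, by omega, fun α' h => ⟨?_, ?_⟩⟩
      · refine h.isCliqueBounded hα hn (by omega) (by omega) ?_ (by omega) (by omega)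
        rintro i hi (hi' | hi') - -
        · omega
        · have := hzα i (by omega) (by omega)
          rw [← hi']
          omega
      · have := h.midSum_eq
        rw [if_neg (by simp), if_neg (by simp)] at this
        exact Or.inr (Or.inr ⟨by omega, hα0, h.lexLT_of_gt (by omega) (by omega)⟩)
    · have h0 := heq 0 (by omega)
      refine ⟨2, by omega, 1, by omega, by omega, by omega, by omega, fun α' h => ⟨?_, ?_⟩⟩
      · refine h.isCliqueBounded hα hn (by omega) (by omega) ?_ (by omega) (by omega)
        rintro i hi (hi' | hi') hi1 -
        · have := hzα 3 (by omega) (by omega)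
          subst hi'
          norm_num
          omega
        · omega
      · have := h.midSum_eq
        rw [if_neg (by simp), if_neg (by simp)] at this
        exact Or.inr (Or.inr ⟨by omega, hα0, h.lexLT_of_gt (by omega) (by omega)⟩)
    · have h0 := heq 0 (by omega)
      have h1 := heq 1 (by omega)
      omega
  · have h0 := heq 0 (by omega)
    have h1 := heq 1 (by omega)
    have h2 := heq 2 (by omega)
    rcases Nat.lt_or_ge t (n - 1) with ht' | ht'
    · have := hzα t ht ht'
      omega
    · obtain rfl : t = n - 1 := by omega
      omega

/-- Exchange when the first difference is at position `0`. If both cliques at `0` are tight, no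
exchange can raise position `0`; instead a factor at `n - 1` is moved to a position in
`2, …, n - 2`. These positions carry only `α 0 < k` in total, so that their cliques are not tight;
neither is `{1, 2}`, since some of that degree lies in `3, …, n - 2`. -/
theorem hasExchange_of_lexLT_zero (hn : 7 ≤ n) (hk : 2 ≤ k) (hα : IsCliqueBounded n k α)
    (hβ : IsCliqueBounded n k β) (hα0 : midSum n α ≠ 0) (hlt : α 0 < β 0) :
    HasExchange n k α β := by
  have hsα := hα.sum_eq hn
  have hsβ := hβ.sum_eq hn
  have hwα := hα.wrap
  have hwβ := hβ.wrap
  have h01α := hα.pair 0 (by omega)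
  have h01β := hβ.pair 0 (by omega)
  have h12α := hα.pair 1 (by omega)
  norm_num at h01α h01β h12α
  by_cases htight : α 0 + α 1 = k ∧ α 0 + α (n - 1) = k
  · -- Outside `{n - 1, 0, 1}` the degree of `β` is at least `β 0`, that of `α` equals `α 0`.
    obtain ⟨s, hs2, hsn, hs⟩ : ∃ s, 2 ≤ s ∧ s < n - 1 ∧ α s < β s := by
      by_contra! hcon
      have hle : midSum n β ≤ midSum n α := Finset.sum_le_sum fun i hi => by
        rw [Finset.mem_Ico] at hi
        exact hcon i (by omega) hi.2
      have := hcon 2 le_rfl (by omega)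
      omega
    refine ⟨s, by omega, n - 1, by omega, by omega, by omega, hs, fun α' h => ⟨?_, ?_⟩⟩
    · refine h.isCliqueBounded hα hn (by omega) (by omega) ?_ (by omega) ?_
      · rintro i hi hi' - hin
        rcases Nat.lt_or_ge i 3 with hi3 | hi3
        · obtain rfl | rfl : i = 1 ∨ i = 2 := by omega
          · norm_num
            omega
          · have := le_midSum (n := n) α (i := 3) le_rfl (by omega)
            norm_num
            omega
        · have := add_le_midSum (n := n) α (i := i) (j := i + 1) hi3 (by omega) (by omega)
          omega
      · have := add_add_le_midSum α hn
        omega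
    · have := h.midSum_eq
      rw [if_neg (by simp)] at this
      exact Or.inr (Or.inl ⟨by omega, hα0, h.lexLT_of_lt (by omega) (by omega)⟩)
  · obtain ⟨r, hrn, hr, hr0, h1, h2, h3⟩ : ∃ r, r < n ∧ 0 < r ∧ 0 < α r ∧
        (α 0 + α 1 = k → r = 1) ∧ (α 0 + α (n - 1) = k → r = n - 1) ∧
        (3 ≤ r → r < n - 1 → α 1 = 0 ∧ α 2 = 0 ∧ α (n - 1) = 0) := by
      by_cases h1 : 0 < α 1 ∧ ¬ (α 0 + α (n - 1) = k)
      · exact ⟨1, by omega, by omega, by omega, by omega, by omega, by omega⟩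
      by_cases h2 : 0 < α (n - 1) ∧ ¬ (α 0 + α 1 = k)
      · exact ⟨n - 1, by omega, by omega, by omega, by omega, by omega, by omega⟩
      by_cases h3 : 0 < α 2
      · exact ⟨2, by omega, by omega, by omega, by omega, by omega, by omega⟩
      obtain ⟨i, hi3, hin, hi0⟩ := exists_of_midSum_ne_zero hα0
      exact ⟨i, by omega, by omega, by omega, by omega, by omega, by omega⟩
    refine ⟨0, by omega, r, by omega, by omega, by omega, hlt, fun α' h => ?_⟩
    have hP : IsCliqueBounded n k α' := by
      refine h.isCliqueBounded hα hn (by omega) (by omega) ?_ (by omega) (by omega)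
      rintro i hi hi' hi0 hi1
      obtain rfl : i = 0 := by omega
      norm_num
      omega
    refine ⟨hP, Or.inr (Or.inl ⟨?_, hα0, h.lexLT_of_lt (by omega) (by omega)⟩)⟩
    have := h.midSum_eq
    rw [if_neg (by simp : 0 ∉ Finset.Ico 3 (n - 1))] at this
    split_ifs at this with hmem
    · rw [Finset.mem_Ico] at hmem
      omega
    · omega

/-- Exchange when the first difference is at a position `t > 0`: the clique of `t` with its
predecessor is not tight, hence moving the next factor after `t` to `t` is admissible. This is
avoided when it would leave no factor in `3, …, n - 2`; a factor at `n - 1` is then used instead. -/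
theorem hasExchange_of_lexLT_pos {t : ℕ} (hn : 7 ≤ n) (hk : 2 ≤ k) (hα : IsCliqueBounded n k α)
    (hβ : IsCliqueBounded n k β) (hα0 : midSum n α ≠ 0) (hβ0 : midSum n β ≠ 0) (ht : 0 < t)
    (htn : t < n) (heq : ∀ i < t, α i = β i) (hlt : α t < β t) : HasExchange n k α β := by
  have hsα := hα.sum_eq hn
  have hsβ := hβ.sum_eq hn
  have hwα := hα.wrap
  have hwβ := hβ.wrap
  -- Both vectors have the same degree, so `α` exceeds `β` somewhere after `t`.
  obtain ⟨r₀, hr₀, htr₀, hr₀pos⟩ : ∃ r < n, t < r ∧ 0 < α r := by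
    by_contra! hcon
    have : ∑ i ∈ Finset.range n, α i < ∑ i ∈ Finset.range n, β i := by
      refine Finset.sum_lt_sum (fun i hi => ?_) ⟨t, Finset.mem_range.2 htn, hlt⟩
      rcases lt_trichotomy i t with h | rfl | h
      · exact (heq i h).le
      · exact hlt.le
      · have := hcon i (Finset.mem_range.1 hi) h
        omega
    rw [hα.sum, hβ.sum] at this
    omega
  obtain ⟨r, ⟨hr, htr, hrpos⟩, hmin⟩ :
      ∃ r, (r < n ∧ t < r ∧ 0 < α r) ∧ ∀ i, t < i → i < r → α i = 0 := by
    classical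
    have hex : ∃ r, r < n ∧ t < r ∧ 0 < α r := ⟨r₀, hr₀, htr₀, hr₀pos⟩
    refine ⟨Nat.find hex, Nat.find_spec hex, fun i hi hir => ?_⟩
    have h1 := Nat.find_min hex hir
    have h2 := (Nat.find_spec hex).1
    by_contra h0
    exact h1 ⟨by omega, hi, by omega⟩
  have hpairt : ∀ i, i + 1 < n → (t = i ∨ t = i + 1) → r ≠ i → r ≠ i + 1 →
      α i + α (i + 1) < k := by
    rintro i hi (rfl | rfl) h1 h2
    · have := hmin (t + 1) (by omega) (by omega)
      have := hβ.pair t hi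
      omega
    · have := heq i (by omega)
      have := hβ.pair i hi
      omega
  -- In the exceptional case the factor at `r` is the only one in `3, …, n - 2`.
  by_cases hbad : midSum n α = 1 ∧ 3 ≤ r ∧ r < n - 1 ∧ t < 3
  swap
  · refine ⟨t, htn, r, hr, by omega, hrpos, hlt, fun α' h => ⟨?_, ?_⟩⟩
    · refine h.isCliqueBounded hα hn (by omega) (by omega) hpairt (by omega) ?_
      have := hβ.triple
      rintro (rfl | rfl | rfl) h1 h2 h3
      · have := hmin 4 (by omega) (by omega)
        have := hmin 5 (by omega) (by omega)
        omega
      · have := hmin 5 (by omega) (by omega)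
        have := heq 3 (by omega)
        omega
      · have := heq 3 (by omega)
        have := heq 4 (by omega)
        omega
    · refine Or.inr (Or.inl ⟨?_, hα0, h.lexLT_of_lt (by omega) (by omega)⟩)
      have := h.midSum_eq
      simp only [Finset.mem_Ico] at this
      split_ifs at this <;> omega
  obtain ⟨hα1, hr3, hrn, ht3⟩ := hbad
  have hαr : α r = 1 := by
    have := le_midSum α hr3 hrn
    omega
  have hz : ∀ i, 3 ≤ i → i < n - 1 → i ≠ r → α i = 0 := fun i h3 hin hir => by
    rcases Nat.lt_or_gt_of_ne hir with h | h
    · have := add_le_midSum (n := n) α h3 h (by omega)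
      omega
    · have := add_le_midSum (n := n) α hr3 h (by omega)
      omega
  -- Otherwise `β` would have its whole degree at the positions up to `t`.
  have hlast : 0 < α (n - 1) := by
    by_contra hcon
    have h0 := heq 0 ht
    obtain rfl | rfl : t = 1 ∨ t = 2 := by omega
    · have := hmin 2 (by omega) (by omega)
      omega
    · have h1 := heq 1 (by omega)
      omega
  -- If `{2, 3}` is tight, position `2` cannot be raised; a factor of `β` beyond `3` is added instead.
  by_cases htight : t = 2 ∧ r = 3 ∧ α 2 + α 3 = k
  · obtain ⟨rfl, rfl, htight⟩ := htight
    have h0 := heq 0 (by omega)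
    have h1 := heq 1 (by omega)
    have h12β := hβ.pair 1 (by omega)
    have h23β := hβ.pair 2 (by omega)
    norm_num at h12β h23β
    obtain ⟨s, hs3, hsn, hβs⟩ := exists_of_midSum_ne_zero hβ0
    have hs3 : s ≠ 3 := by
      rintro rfl
      omega
    have hs0 := hz s (by omega) hsn hs3
    refine ⟨s, by omega, n - 1, by omega, by omega, hlast, by omega, fun α' h => ⟨?_, ?_⟩⟩
    · refine h.isCliqueBounded hα hn (by omega) (by omega) ?_ (by omega) ?_
      · rintro i hi (rfl | rfl) h1 h2
        · have := hz (s + 1) (by omega) (by omega) (by omega)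
          omega
        · have := le_midSum (n := n) α (i := i) (by omega) (by omega)
          omega
      · have := add_add_le_midSum α hn
        omega
    · have := h.midSum_eq
      rw [if_neg (by simp)] at this
      exact Or.inr (Or.inl ⟨by omega, hα0, h.lexLT_of_lt (by omega) (by omega)⟩)
  · refine ⟨t, by omega, n - 1, by omega, by omega, hlast, by omega, fun α' h => ⟨?_, ?_⟩⟩
    · refine h.isCliqueBounded hα hn (by omega) (by omega) ?_ (by omega) (by omega)
      intro i hi hti _ _
      by_cases hir : r = i + 1
      · obtain ⟨rfl, rfl⟩ : t = 2 ∧ i = 2 := by omega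
        have := hα.pair 2 hi
        subst hir
        norm_num at this ⊢
        omega
      · exact hpairt i hi hti (by omega) hir
    · have := h.midSum_eq
      rw [if_neg (by simp)] at this
      exact Or.inr (Or.inl ⟨by omega, hα0, h.lexLT_of_lt (by omega) (by omega)⟩)

theorem hasExchange_of_precedes (hn : 7 ≤ n) (hk : 2 ≤ k) (hα : IsCliqueBounded n k α)
    (hβ : IsCliqueBounded n k β) (h : Precedes n β α) : HasExchange n k α β := by
  rcases h with ⟨hβ0, hα0⟩ | ⟨hβ0, hα0, t, htn, heq, hlt⟩ | ⟨hβ0, hα0, hlex⟩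
  · exact hasExchange_of_midSum_eq_zero hn (by omega) hα hα0 hβ0
  · rcases Nat.eq_zero_or_pos t with rfl | ht
    · exact hasExchange_of_lexLT_zero hn hk hα hβ hα0 hlt
    · exact hasExchange_of_lexLT_pos hn hk hα hβ hα0 hβ0 ht htn heq hlt
  · exact hasExchange_of_midSum_eq_zero_of_midSum_eq_zero hn hα hβ hα0 hβ0 hlex

end Exchange

/-! ### Linear quotients from exchanges -/

section LinearQuotients

open MvPolynomial

variable {σ : Type*} {K : Type*} [Field K]

/-- If every monomial of `T` contains to a higher power some variable `x_s` whose product with `x ^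
m` lies in `(T)`, then the colon ideal `(T) : x ^ m` is generated by those variables. -/
theorem colon_span_monomial {T : Set (σ →₀ ℕ)} {m : σ →₀ ℕ}
    (h : ∀ m' ∈ T, ∃ s, m s < m' s ∧ ∃ m'' ∈ T, m'' ≤ m + Finsupp.single s 1) :
    (Ideal.span ((fun t => monomial t (1 : K)) '' T)).colon {monomial m (1 : K)} =
      Ideal.span ((X : σ → MvPolynomial σ K) '' {s | ∃ m'' ∈ T, m'' ≤ m + Finsupp.single s 1}) := by
  ext f
  rw [Submodule.mem_colon_singleton, smul_eq_mul, mem_ideal_span_monomial_image,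
    mem_ideal_span_X_image]
  constructor
  · intro hf x hx
    obtain ⟨m', hm', hle⟩ := hf (x + m) (by
      rw [mem_support_iff, coeff_mul_monomial, mul_one]
      exact mem_support_iff.1 hx)
    obtain ⟨s, hs, hm''⟩ := h m' hm'
    refine ⟨s, hm'', fun h0 => ?_⟩
    have := hle s
    rw [Finsupp.add_apply] at this
    omega
  · intro hf y hy
    classical
    rw [mem_support_iff, coeff_mul_monomial', mul_one] at hy
    split_ifs at hy with hmy
    · obtain ⟨s, ⟨m'', hm'', hle⟩, hs⟩ := hf (y - m) (mem_support_iff.2 hy)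
      refine ⟨m'', hm'', hle.trans ?_⟩
      calc m + Finsupp.single s 1 ≤ m + (y - m) := by
            gcongr
            rwa [Finsupp.single_le_iff, Nat.one_le_iff_ne_zero]
        _ = y := add_tsub_cancel_of_le hmy
    · exact absurd rfl hy

/-- Monomials of one degree are the minimal generators of the ideal that they generate. -/
theorem minimalGenerators_span_monomial {S : Set (σ →₀ ℕ)} {d : ℕ} (hd : ∀ m ∈ S, m.degree = d) :
    minimalGenerators (Ideal.span ((fun t => monomial t (1 : K)) '' S)) = S := by
  have hmem : ∀ m : σ →₀ ℕ, monomial m (1 : K) ∈ Ideal.span ((fun t => monomial t (1 : K)) '' S) ↔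
      ∃ t ∈ S, t ≤ m := fun m => by
    classical
    rw [mem_ideal_span_monomial_image, support_monomial, if_neg one_ne_zero]
    simp
  ext m
  simp only [minimalGenerators, hmem, Set.mem_ofPred_eq]
  constructor
  · rintro ⟨⟨t, ht, htm⟩, hmin⟩
    rwa [le_antisymm (hmin ⟨t, ht, le_rfl⟩ htm) htm]
  · refine fun hm => ⟨⟨m, hm, le_rfl⟩, ?_⟩
    rintro m' ⟨t, ht, htm'⟩ hm'm
    obtain ⟨c, rfl⟩ := exists_add_of_le (htm'.trans hm'm)
    have hc : c.degree = 0 := by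
      have h1 := hd _ hm
      rw [map_add, hd t ht] at h1
      omega
    rw [Finsupp.degree_eq_zero_iff] at hc
    simpa [hc] using htm'

/-- Linear quotients for an equigenerated monomial ideal, the generators being ordered by an
injective key with values in a linear order. -/
theorem hasLinearQuotients_of_key {S : Set (σ →₀ ℕ)} (hS : S.Finite) {d : ℕ}
    (hd : ∀ m ∈ S, m.degree = d) {L : Type*} [LinearOrder L] (key : (σ →₀ ℕ) → L)
    (hkey : Set.InjOn key S)
    (h : ∀ m ∈ S, ∀ m' ∈ S, key m' < key m →
      ∃ s, m s < m' s ∧ ∃ m'' ∈ S, key m'' < key m ∧ m'' ≤ m + Finsupp.single s 1) :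
    HasLinearQuotients (Ideal.span ((fun t => monomial t (1 : K)) '' S)) := by
  classical
  refine ⟨⟨S, rfl⟩, Or.inr ?_⟩
  obtain ⟨r, M, hmono, hrange⟩ : ∃ (r : ℕ) (M : Fin r → (σ →₀ ℕ)),
      StrictMono (key ∘ M) ∧ Set.range M = S := by
    let T : Finset L := hS.toFinset.image key
    have hT : ∀ i, ∃ m ∈ S, key m = T.orderEmbOfFin rfl i := fun i => by
      obtain ⟨m, hm, hmi⟩ := Finset.mem_image.1 (T.orderEmbOfFin_mem rfl i)
      exact ⟨m, hS.mem_toFinset.1 hm, hmi⟩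
    choose M hMS hM using hT
    refine ⟨_, M, fun i j hij => ?_, ?_⟩
    · simpa [hM] using hij
    · ext m
      constructor
      · rintro ⟨i, rfl⟩
        exact hMS i
      · intro hm
        have hmT : key m ∈ T := Finset.mem_image_of_mem _ (by simpa using hm)
        rw [← Finset.mem_coe, ← T.range_orderEmbOfFin rfl] at hmT
        obtain ⟨i, hi⟩ := hmT
        exact ⟨i, hkey (hMS i) hm ((hM i).trans hi)⟩
  have hMS : ∀ i, M i ∈ S := fun i => hrange ▸ Set.mem_range_self i
  refine ⟨r, M, fun i j hij => hmono.injective (congrArg key hij),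
    hrange.trans (minimalGenerators_span_monomial hd).symm, fun i _ => ?_⟩
  have himage : (fun j => monomial (M j) (1 : K)) '' {j | j < i} =
      (fun t => monomial t (1 : K)) '' (M '' {j | j < i}) := by
    rw [Set.image_image]
  rw [himage]
  refine ⟨_, colon_span_monomial ?_⟩
  rintro _ ⟨j, hj, rfl⟩
  obtain ⟨s, hs, m'', hm'', hlt, hle⟩ := h _ (hMS i) _ (hMS j) (hmono hj)
  rw [← hrange] at hm''
  obtain ⟨l, rfl⟩ := hm''
  exact ⟨s, hs, M l, ⟨l, hmono.lt_iff_lt.1 hlt, rfl⟩, hle⟩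

end LinearQuotients

/-! ### Generators of the powers of the edge ideal -/

section Powers

variable {V : Type*}

/-- The exponents of the products of `k` edges of `G`. -/
def edgeProducts (G : SimpleGraph V) : ℕ → Set (V →₀ ℕ)
  | 0 => {0}
  | k + 1 => {m | ∃ m' ∈ edgeProducts G k, ∃ x y, G.Adj x y ∧
      m = m' + (Finsupp.single x 1 + Finsupp.single y 1)}

theorem edgeIdeal_pow (K : Type*) [Field K] (G : SimpleGraph V) (k : ℕ) :
    edgeIdeal K G ^ k =
      Ideal.span ((fun t => MvPolynomial.monomial t (1 : K)) '' edgeProducts G k) := by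
  induction k with
  | zero => simp [edgeProducts, Ideal.one_eq_top]
  | succ k ih =>
    rw [pow_succ, ih, edgeIdeal, Ideal.span_mul_span']
    congr 1
    ext f
    simp only [Set.mem_mul, Set.mem_image, edgeProducts, Set.mem_ofPred_eq]
    constructor
    · rintro ⟨_, ⟨m, hm, rfl⟩, _, ⟨x, y, hxy, rfl⟩, rfl⟩
      exact ⟨_, ⟨m, hm, x, y, hxy, rfl⟩, by simp [MvPolynomial.X, MvPolynomial.monomial_mul]⟩
    · rintro ⟨_, ⟨m, hm, x, y, hxy, rfl⟩, rfl⟩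
      exact ⟨_, ⟨m, hm, rfl⟩, _, ⟨x, y, hxy, rfl⟩,
        by simp [MvPolynomial.X, MvPolynomial.monomial_mul]⟩

theorem degree_of_mem_edgeProducts {G : SimpleGraph V} {k : ℕ} {m : V →₀ ℕ}
    (hm : m ∈ edgeProducts G k) : m.degree = 2 * k := by
  induction k generalizing m with
  | zero =>
    obtain rfl : m = 0 := hm
    simp
  | succ k ih =>
    obtain ⟨m', hm', x, y, -, rfl⟩ := hm
    simp [ih hm']
    ring

/-- The vertices of `G` are labelled bijectively by the positions `0, …, n - 1` so that the
complement of `G` is the `n`-cycle with the chord `{3, 5}`. Labels `v i` with `n ≤ i` are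
irrelevant. -/
structure IsChordedCycleLabelling (G : SimpleGraph V) (n : ℕ) (v : ℕ → V) : Prop where
  inj : ∀ i < n, ∀ j < n, v i = v j → i = j
  surj : ∀ x, ∃ i < n, v i = x
  adj : ∀ i j, i < j → j < n →
    (G.Adj (v i) (v j) ↔ ¬ (j = i + 1 ∨ (i = 0 ∧ j = n - 1) ∨ (i = 3 ∧ j = 5)))

/-- An edge meets each clique of the complement at most once. -/
theorem IsCliqueBounded.add_pair {n k i j : ℕ} {α β : ℕ → ℕ} (hα : IsCliqueBounded n k α)
    (hn : 7 ≤ n) (hij : i < j) (hj : j < n)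
    (hadj : ¬ (j = i + 1 ∨ (i = 0 ∧ j = n - 1) ∨ (i = 3 ∧ j = 5)))
    (hβ : ∀ l < n, β l = α l + ((if i = l then 1 else 0) + (if j = l then 1 else 0))) :
    IsCliqueBounded n (k + 1) β := by
  refine ⟨?_, fun l hl => ?_, ?_, ?_⟩
  · rw [Finset.sum_congr rfl fun l hl => hβ l (Finset.mem_range.1 hl), Finset.sum_add_distrib,
      Finset.sum_add_distrib, Finset.sum_ite_eq, Finset.sum_ite_eq, hα.sum,
      if_pos (Finset.mem_range.2 (hij.trans hj)), if_pos (Finset.mem_range.2 hj)]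
    ring
  · have := hα.pair l hl
    rw [hβ l (by omega), hβ (l + 1) hl]
    split_ifs <;> omega
  · have := hα.wrap
    rw [hβ 0 (by omega), hβ (n - 1) (by omega)]
    split_ifs <;> omega
  · have := hα.triple
    rw [hβ 3 (by omega), hβ 4 (by omega), hβ 5 (by omega)]
    split_ifs <;> omega

/-- A factor can be split off: an edge `{x, y}` whose removal from `α` leaves a clique-bounded
vector. Here `x` and `y` are the positions of the first and the `(k + 2)`-nd of the `2 * (k + 1)`
factors listed in increasing order of position. -/
theorem IsCliqueBounded.exists_pair {n k : ℕ} {α : ℕ → ℕ} (hα : IsCliqueBounded n (k + 1) α)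
    (hn : 7 ≤ n) :
    ∃ x y, x < y ∧ y < n ∧ ¬ (y = x + 1 ∨ (x = 0 ∧ y = n - 1) ∨ (x = 3 ∧ y = 5)) ∧
      0 < α x ∧ 0 < α y ∧
      ∀ α' : ℕ → ℕ,
        (∀ l < n, α' l + ((if x = l then 1 else 0) + (if y = l then 1 else 0)) = α l) →
          IsCliqueBounded n k α' := by
  classical
  obtain ⟨S, hSdef⟩ : ∃ S : ℕ → ℕ, S = fun j => ∑ i ∈ Finset.range j, α i := ⟨_, rfl⟩
  have hS0 : S 0 = 0 := by simp [hSdef]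
  have hS : ∀ j, S (j + 1) = S j + α j := fun j => by simp [hSdef, Finset.sum_range_succ]
  have hmono : Monotone S := monotone_nat_of_le_succ fun j => by rw [hS]; omega
  have hSn : S n = 2 * (k + 1) := by rw [hSdef]; exact hα.sum
  have hn1 : n - 1 + 1 = n := by omega
  have hexx : ∃ x, 0 < S (x + 1) := ⟨n - 1, by rw [hn1]; omega⟩
  have hexy : ∃ y, k + 1 < S (y + 1) := ⟨n - 1, by rw [hn1]; omega⟩
  obtain ⟨x, hx, hxmin⟩ : ∃ x, 0 < S (x + 1) ∧ ∀ i ≤ x, S i = 0 := by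
    refine ⟨Nat.find hexx, Nat.find_spec hexx, fun i hi => ?_⟩
    rcases Nat.eq_zero_or_pos i with rfl | h
    · exact hS0
    · have := Nat.find_min hexx (m := i - 1) (by omega)
      rw [Nat.sub_add_cancel h] at this
      omega
  obtain ⟨y, hy, hymin, hyn⟩ : ∃ y, k + 1 < S (y + 1) ∧ S y ≤ k + 1 ∧ y < n := by
    refine ⟨Nat.find hexy, Nat.find_spec hexy, ?_, ?_⟩
    · rcases Nat.eq_zero_or_pos (Nat.find hexy) with h | h
      · rw [h, hS0]
        omega
      · have := Nat.find_min hexy (m := Nat.find hexy - 1) (by omega)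
        rw [Nat.sub_add_cancel h] at this
        omega
    · have := Nat.find_min' hexy (m := n - 1) (by rw [hn1]; omega)
      omega
  -- `S` counts factors: none lies before `x`, at most `k + 1` before `y`, and more up to `y`.
  have hSx := hxmin x le_rfl
  have hαx := hS x
  have hαy := hS y
  have hle : ∀ l < n, α l ≤ k + 1 := fun l hl => by
    rcases Nat.eq_zero_or_pos l with rfl | h
    · have := hα.pair 0 (by omega)
      omega
    · have := hα.pair (l - 1) (by omega)
      rw [Nat.sub_add_cancel h] at this
      omega
  have hxy : x < y := by
    rcases lt_trichotomy x y with h | rfl | h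
    · exact h
    · have := hle x hyn
      omega
    · have := hxmin (y + 1) h
      omega
  have hwrap := hα.wrap
  refine ⟨x, y, hxy, hyn, ?_, by omega, by omega, fun α' h => ?_⟩
  · rintro (rfl | ⟨rfl, rfl⟩ | ⟨rfl, rfl⟩)
    · have := hα.pair x hyn
      omega
    · rw [hn1] at hαy
      omega
    · have := hα.triple
      have := hS 4
      norm_num at *
      omega
  · refine ⟨?_, fun i hi => ?_, ?_, ?_⟩
    · have hsum := hα.sum
      rw [← Finset.sum_congr rfl fun l hl => h l (Finset.mem_range.1 hl), Finset.sum_add_distrib,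
        Finset.sum_add_distrib, Finset.sum_ite_eq, Finset.sum_ite_eq,
        if_pos (Finset.mem_range.2 (hxy.trans hyn)), if_pos (Finset.mem_range.2 hyn)] at hsum
      omega
    · have h0 := h i (by omega)
      have h1 := h (i + 1) hi
      have := hα.pair i hi
      have h2 := hS i
      have h3 : S (i + 2) = S (i + 1) + α (i + 1) := hS (i + 1)
      by_cases hhit : x = i ∨ x = i + 1 ∨ y = i ∨ y = i + 1
      · split_ifs at h0 h1 <;> omega
      · have : α i + α (i + 1) ≤ k := by
          rcases Nat.lt_or_ge i x with hix | hix
          · have := hxmin (i + 1) hix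
            have := hxmin (i + 2) (by omega)
            omega
          · have h4 : S (x + 1) ≤ S i := hmono (by omega)
            rcases Nat.lt_or_ge i y with hiy | hiy
            · have h5 : S (i + 2) ≤ S y := hmono (by omega)
              omega
            · have h5 : S (y + 1) ≤ S i := hmono (by omega)
              have h6 : S (i + 2) ≤ S n := hmono (by omega)
              omega
        omega
    · have h0 := h 0 (by omega)
      have h1 := h (n - 1) (by omega)
      by_cases hhit : x = 0 ∨ y = n - 1
      · split_ifs at h0 h1 <;> omega
      · have h2 := hxmin 1 (by omega)
        have h3 := hS 0
        have h4 := hS (n - 1)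
        have h5 : S (y + 1) ≤ S (n - 1) := hmono (by omega)
        rw [hn1] at h4
        norm_num at h3
        omega
    · have h0 := h 3 (by omega)
      have h1 := h 4 (by omega)
      have h2 := h 5 (by omega)
      have := hα.triple
      by_cases hhit : (x = 3 ∨ x = 4 ∨ x = 5) ∨ (y = 3 ∨ y = 4 ∨ y = 5)
      · split_ifs at h0 h1 h2 <;> omega
      · have h3 : S 4 = S 3 + α 3 := hS 3
        have h4 : S 5 = S 4 + α 4 := hS 4
        have h5 : S 6 = S 5 + α 5 := hS 5
        have : α 3 + α 4 + α 5 ≤ k := by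
          rcases Nat.lt_or_ge 5 x with hix | hix
          · have := hxmin 6 hix
            omega
          · have h4 : S (x + 1) ≤ S 3 := hmono (by omega)
            rcases Nat.lt_or_ge 5 y with hiy | hiy
            · have h5 : S 6 ≤ S y := hmono (by omega)
              omega
            · have h5 : S (y + 1) ≤ S 3 := hmono (by omega)
              have h6 : S 6 ≤ S n := hmono (by omega)
              omega
        omega

variable {G : SimpleGraph V} {n : ℕ} {v : ℕ → V}

theorem IsChordedCycleLabelling.single_apply (hv : IsChordedCycleLabelling G n v) {i l : ℕ}
    (hi : i < n) (hl : l < n) : Finsupp.single (v i) 1 (v l) = if i = l then 1 else 0 := by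
  classical
  rw [Finsupp.single_apply]
  exact if_congr ⟨hv.inj i hi l hl, congrArg v⟩ rfl rfl

theorem IsChordedCycleLabelling.ext (hv : IsChordedCycleLabelling G n v) {m m' : V →₀ ℕ}
    (h : ∀ l < n, m (v l) = m' (v l)) : m = m' := by
  ext x
  obtain ⟨i, hi, rfl⟩ := hv.surj x
  exact h i hi

/-- Products of `k` edges are recognized by their degree and the clique bounds. -/
theorem IsChordedCycleLabelling.mem_edgeProducts (hv : IsChordedCycleLabelling G n v)
    (hn : 7 ≤ n) {k : ℕ} {m : V →₀ ℕ} :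
    m ∈ edgeProducts G k ↔ IsCliqueBounded n k fun i => m (v i) := by
  induction k generalizing m with
  | zero =>
    constructor
    · rintro rfl
      exact ⟨by simp, by simp, by simp, by simp⟩
    · intro h
      refine hv.ext fun l hl => ?_
      have := h.sum
      simp only [mul_zero, Finset.sum_eq_zero_iff, Finset.mem_range] at this
      exact this l hl
  | succ k ih =>
    constructor
    · rintro ⟨m', hm', x, y, hxy, rfl⟩
      obtain ⟨i, hi, rfl⟩ := hv.surj x
      obtain ⟨j, hj, rfl⟩ := hv.surj y
      wlog hij : i < j generalizing i j
      · have hne : i ≠ j := fun h => hxy.ne (congrArg v h)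
        rw [add_comm (Finsupp.single (v i) 1)]
        exact this j hj i hi hxy.symm (by omega)
      refine (ih.1 hm').add_pair hn hij hj ((hv.adj i j hij hj).1 hxy) fun l hl => ?_
      simp only [Finsupp.add_apply, hv.single_apply hi hl, hv.single_apply hj hl]
    · intro h
      obtain ⟨x, y, hxy, hy, hadj, hx0, hy0, hα⟩ := h.exists_pair hn
      have key : ∀ l < n, (m - Finsupp.single (v x) 1 - Finsupp.single (v y) 1 : V →₀ ℕ) (v l) +
          ((if x = l then 1 else 0) + (if y = l then 1 else 0)) = m (v l) := fun l hl => by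
        simp only [Finsupp.tsub_apply, hv.single_apply (hxy.trans hy) hl, hv.single_apply hy hl]
        split_ifs with h1 h2 h2
        · omega
        · subst h1; omega
        · subst h2; omega
        · omega
      refine ⟨_, ih.2 (hα _ key), v x, v y, (hv.adj x y hxy hy).2 hadj, hv.ext fun l hl => ?_⟩
      rw [Finsupp.add_apply, Finsupp.add_apply, hv.single_apply (hxy.trans hy) hl,
        hv.single_apply hy hl, key l hl]

/-! ### The order of the generators -/

/-- A key whose comparison is the generator order `Precedes`: first the block, then the exponents
lexicographically, negated in the first block to make the order descending there. -/
noncomputable def generatorKey (n : ℕ) (v : ℕ → V) (m : V →₀ ℕ) : ℕ ×ₗ Lex (Fin n → ℤ) :=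
  toLex (if midSum n (fun i => m (v i)) = 0 then (1, toLex fun i => (m (v i) : ℤ))
    else (0, toLex fun i => -(m (v i) : ℤ)))

theorem generatorKey_lt_iff {m' m : V →₀ ℕ} :
    generatorKey n v m' < generatorKey n v m ↔
      Precedes n (fun i => m' (v i)) (fun i => m (v i)) := by
  have hlex : ∀ f g : ℕ → ℤ, (toLex (fun i : Fin n => f i) < toLex (fun i : Fin n => g i)) ↔
      ∃ t < n, (∀ i < t, f i = g i) ∧ f t < g t := fun f g => by
    constructor
    · rintro ⟨t, h1, h2⟩
      exact ⟨t, t.2, fun i hi => h1 ⟨i, hi.trans t.2⟩ hi, h2⟩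
    · rintro ⟨t, ht, h1, h2⟩
      exact ⟨⟨t, ht⟩, fun i hi => h1 i hi, h2⟩
  have hpos : (toLex (fun i : Fin n => (m' (v i) : ℤ)) < toLex fun i : Fin n => (m (v i) : ℤ)) ↔
      LexLT n (fun i => m' (v i)) (fun i => m (v i)) :=
    (hlex (fun i => (m' (v i) : ℤ)) fun i => (m (v i) : ℤ)).trans (by simp [LexLT])
  have hneg : (toLex (fun i : Fin n => -(m' (v i) : ℤ)) < toLex fun i : Fin n => -(m (v i) : ℤ)) ↔
      LexLT n (fun i => m (v i)) (fun i => m' (v i)) :=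
    (hlex (fun i => -(m' (v i) : ℤ)) fun i => -(m (v i) : ℤ)).trans (by simp [LexLT, eq_comm])
  unfold generatorKey Precedes
  split_ifs with h1 h2 h2 <;> simp [Prod.Lex.toLex_lt_toLex, h1, h2, hpos, hneg]

theorem IsChordedCycleLabelling.generatorKey_injective (hv : IsChordedCycleLabelling G n v) :
    Function.Injective (generatorKey n v) := by
  intro m m' h
  refine hv.ext fun l hl => ?_
  unfold generatorKey at h
  split_ifs at h <;> simp at h
  all_goals
    have := congrFun h ⟨l, hl⟩
    simpa using this

theorem IsChordedCycleLabelling.hasLinearQuotients [Finite V] (K : Type*) [Field K]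
    (hv : IsChordedCycleLabelling G n v)
    (hn : 7 ≤ n) {k : ℕ} (hk : 2 ≤ k) : HasLinearQuotients (edgeIdeal K G ^ k) := by
  rw [edgeIdeal_pow]
  refine hasLinearQuotients_of_key ?_ (fun m hm => degree_of_mem_edgeProducts hm)
    (generatorKey n v) hv.generatorKey_injective.injOn fun m hm m' hm' hlt => ?_
  · refine Set.Finite.subset (Finsupp.finite_of_degree_le (2 * k)) fun m hm => ?_
    exact (degree_of_mem_edgeProducts hm).le
  · rw [generatorKey_lt_iff] at hlt
    obtain ⟨s, hs, r, hr, hsr, hr0, hsm, h⟩ := hasExchange_of_precedes hn hk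
      ((hv.mem_edgeProducts hn).1 hm) ((hv.mem_edgeProducts hn).1 hm') hlt
    have hex : IsExchange n (fun i => m (v i))
        (fun i => (m + Finsupp.single (v s) 1 - Finsupp.single (v r) 1 : V →₀ ℕ) (v i)) s r := by
      have happly : ∀ i < n, (m + Finsupp.single (v s) 1 - Finsupp.single (v r) 1 : V →₀ ℕ) (v i) =
          m (v i) + (if s = i then 1 else 0) - (if r = i then 1 else 0) := fun i hi => by
        rw [Finsupp.tsub_apply, Finsupp.add_apply, hv.single_apply hs hi, hv.single_apply hr hi]
      refine ⟨hsr, (happly s hs).trans ?_, ?_, fun i hi his hir => (happly i hi).trans ?_⟩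
      · simp [hsr.symm]
      · dsimp only at hr0 ⊢
        rw [happly r hr, if_neg hsr, if_pos rfl]
        omega
      · simp [his.symm, hir.symm]
    obtain ⟨hP, hprec⟩ := h _ hex
    exact ⟨v s, hsm, _, (hv.mem_edgeProducts hn).2 hP, generatorKey_lt_iff.2 hprec,
      tsub_le_self⟩

end Powers

/-! ### The modified anticycle as the complement of a chorded cycle -/

section Relabelling

theorem cycleGraph_adj_iff_eq_add_one {n : ℕ} [NeZero n] (hn : 2 ≤ n) (x y : Fin n) :
    (SimpleGraph.cycleGraph n).Adj x y ↔ x = y + 1 ∨ y = x + 1 := by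
  obtain ⟨m, rfl⟩ : ∃ m, n = m + 2 := ⟨n - 2, by omega⟩
  rw [SimpleGraph.cycleGraph_adj, sub_eq_iff_eq_add', sub_eq_iff_eq_add']

/-- The vertex in `Fin n` congruent to the integer `z`. -/
def residue (n : ℕ) [NeZero n] (z : ℤ) : Fin n :=
  ⟨(z % n).toNat, by
    have h0 : (0 : ℤ) < n := by exact_mod_cast NeZero.pos n
    have := Int.emod_lt_of_pos z h0
    have := Int.emod_nonneg z h0.ne'
    omega⟩

variable {n : ℕ} [NeZero n]

theorem coe_residue (z : ℤ) : ((residue n z : ℕ) : ℤ) = z % n :=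
  Int.toNat_of_nonneg (Int.emod_nonneg z (by exact_mod_cast NeZero.ne n))

theorem residue_eq_iff {z w : ℤ} : residue n z = residue n w ↔ (n : ℤ) ∣ z - w := by
  rw [Fin.ext_iff, ← Int.natCast_inj, coe_residue, coe_residue, 
    Int.emod_eq_emod_iff_emod_sub_eq_zero, Int.dvd_iff_emod_eq_zero]

theorem residue_natCast (x : Fin n) : residue n (x : ℕ) = x := by
  rw [Fin.ext_iff, ← Int.natCast_inj, coe_residue]
  exact_mod_cast Nat.mod_eq_of_lt x.2

theorem residue_add_one (hn : 2 ≤ n) (z : ℤ) : residue n z + 1 = residue n (z + 1) := by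
  have h1 : ((1 : Fin n) : ℕ) = 1 := by
    rw [Fin.val_one', Nat.mod_eq_of_lt (by omega)]
  rw [Fin.ext_iff, ← Int.natCast_inj, coe_residue, Fin.val_add, h1]
  push_cast
  rw [coe_residue, Int.emod_add_emod]

theorem residue_eq_iff_of_lt {z w : ℤ} (h1 : z - w < 2 * n) (h2 : w - z < 2 * n) :
    residue n z = residue n w ↔ z - w = 0 ∨ z - w = n ∨ z - w = -n := by
  rw [residue_eq_iff]
  constructor
  · rintro ⟨c, hc⟩
    have h0 : (0 : ℤ) < n := by exact_mod_cast NeZero.pos n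
    have h3 : c < 2 := by nlinarith
    have h4 : -2 < c := by nlinarith
    rw [hc]
    obtain rfl | rfl | rfl : c = -1 ∨ c = 0 ∨ c = 1 := by omega
    all_goals simp
  · rintro (h | h | h) <;> rw [h] <;> simp

theorem modifiedAnticycle_adj (hn : 2 ≤ n) (a b x y : Fin n) :
    (modifiedAnticycle n a b).Adj x y ↔
      (x ≠ y ∧ ¬ (x = y + 1 ∨ y = x + 1)) ∧
          ¬ ((x = a ∧ y = b ∨ x = b ∧ y = a) ∨
            (x = a + 1 ∧ y = b + 1 ∨ x = b + 1 ∧ y = a + 1)) ∨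
        (x = a + 1 ∧ y = a ∨ x = a ∧ y = a + 1) ∧ x ≠ y := by
  rw [modifiedAnticycle, SimpleGraph.sup_adj, SimpleGraph.deleteEdges_adj, anticycle,
    SimpleGraph.compl_adj, cycleGraph_adj_iff_eq_add_one hn, SimpleGraph.edge_adj]
  simp only [Set.mem_insert_iff, Set.mem_singleton_iff, Sym2.eq_iff, ne_eq]

/-- The transposition of `4` and `5`, with values in `ℤ`. It turns the cyclic order of the anticycle
into that of the chorded cycle. -/
def swapped (i : ℕ) : ℤ := if i = 4 then 5 else if i = 5 then 4 else i

/-- A labelling from an `n`-periodic parametrization `f` of the vertices along the cycle of the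
anticycle, in either direction, such that the removed edges are `{f 3, f 5}` and `{f 4, f 6}` and
the added edge is `{f 5, f 6}`. After `4` and `5` are swapped, the cycle runs through `f 3, f 5, f
4, f 6`, and `{f 3, f 4}` becomes the chord. -/
theorem isChordedCycleLabelling_of_parametrization (hn : 7 ≤ n) {a b : Fin n} (f : ℤ → Fin n)
    (hf : ∀ z w : ℤ, z - w < 2 * n → w - z < 2 * n →
      (f z = f w ↔ z - w = 0 ∨ z - w = n ∨ z - w = -n))
    (hcyc : ∀ z w : ℤ, (f z = f w + 1 ∨ f w = f z + 1) ↔ (f z = f (w + 1) ∨ f w = f (z + 1)))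
    (hab : (a = f 5 ∧ a + 1 = f 6 ∧ b = f 3 ∧ b + 1 = f 4) ∨
      (a = f 6 ∧ a + 1 = f 5 ∧ b = f 4 ∧ b + 1 = f 3)) :
    IsChordedCycleLabelling (modifiedAnticycle n a b) n fun i => f (swapped i) := by
  have hu : ∀ i < n, 0 ≤ swapped i ∧ swapped i < n := fun i hi => by
    unfold swapped; split_ifs <;> omega
  have hinj : ∀ i < n, ∀ j < n, f (swapped i) = f (swapped j) → i = j := fun i hi j hj h => by
    have h1 := hu i hi
    have h2 := hu j hj
    rw [hf _ _ (by omega) (by omega)] at h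
    unfold swapped at *
    split_ifs at * <;> omega
  refine ⟨hinj, fun x => ?_, fun i j hij hj => ?_⟩
  · obtain ⟨i, hi⟩ := Finite.injective_iff_surjective.1
      (show Function.Injective fun i : Fin n => f (swapped i) from
        fun i j h => Fin.ext (hinj i i.2 j j.2 h)) x
    exact ⟨i, i.2, hi⟩
  · have h1 := hu i (hij.trans hj)
    have h2 := hu j hj
    have hconst : ∀ c : ℤ, 0 ≤ c → c < 7 → ∀ z : ℤ, 0 ≤ z → z < n → (f z = f c ↔ z = c) :=
      fun c hc0 hc7 z hz0 hzn => by
        rw [hf _ _ (by omega) (by omega)]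
        omega
    have hne : f (swapped i) = f (swapped j) ↔ swapped i = swapped j := by
      rw [hf _ _ (by omega) (by omega)]
      omega
    rw [modifiedAnticycle_adj (by omega), hcyc, hf _ (swapped j + 1) (by omega) (by omega),
      hf _ (swapped i + 1) (by omega) (by omega), Ne, hne]
    have h3i := hconst 3 (by omega) (by omega) _ h1.1 h1.2
    have h4i := hconst 4 (by omega) (by omega) _ h1.1 h1.2
    have h5i := hconst 5 (by omega) (by omega) _ h1.1 h1.2
    have h6i := hconst 6 (by omega) (by omega) _ h1.1 h1.2
    have h3j := hconst 3 (by omega) (by omega) _ h2.1 h2.2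
    have h4j := hconst 4 (by omega) (by omega) _ h2.1 h2.2
    have h5j := hconst 5 (by omega) (by omega) _ h2.1 h2.2
    have h6j := hconst 6 (by omega) (by omega) _ h2.1 h2.2
    rcases hab with ⟨ha, ha', hb, hb'⟩ | ⟨ha, ha', hb, hb'⟩ <;>
    · rw [ha', hb', ha, hb, h3i, h4i, h5i, h6i, h3j, h4j, h5j, h6j]
      clear h3i h4i h5i h6i h3j h4j h5j h6j hne hconst hinj hu hf hcyc
      unfold swapped at *
      split_ifs at * <;> omega

theorem exists_isChordedCycleLabelling (hn : 7 ≤ n) {a b : Fin n}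
    (hab : ((a : ℕ) : ℤ) - ((b : ℕ) : ℤ) ≡ 2 [ZMOD (n : ℤ)] ∨
      ((a : ℕ) : ℤ) - ((b : ℕ) : ℤ) ≡ -2 [ZMOD (n : ℤ)]) :
    ∃ v, IsChordedCycleLabelling (modifiedAnticycle n a b) n v := by
  have hadd := residue_add_one (n := n) (by omega)
  obtain ⟨A, rfl⟩ : ∃ A, a = residue n A := ⟨_, (residue_natCast a).symm⟩
  have hb : ∀ c : ℤ, ((residue n A : ℕ) : ℤ) - ((b : ℕ) : ℤ) ≡ c [ZMOD (n : ℤ)] →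
      b = residue n (A - c) := fun c h => by
    rw [← residue_natCast b, residue_eq_iff]
    rw [coe_residue] at h
    have h1 := h.symm.dvd
    have h2 : (n : ℤ) ∣ A - A % n := Int.dvd_self_sub_emod
    have h3 : ((b : ℕ) : ℤ) - (A - c) = -((A % n - (b : ℕ) - c) + (A - A % n)) := by ring
    rw [h3]
    exact (dvd_add h1 h2).neg_right
  -- The parametrization runs forwards with `a = f 5` or backwards with `a = f 6`.
  rcases hab with h | h
  · refine ⟨_, isChordedCycleLabelling_of_parametrization hn (fun z => residue n (A + (z - 5)))
      (fun z w h1 h2 => ?_) (fun z w => ?_) (Or.inl ?_)⟩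
    · rw [residue_eq_iff_of_lt (by omega) (by omega)]
      omega
    · rw [hadd, hadd]
      ring_nf
    · rw [hb 2 h, hadd, hadd]
      ring_nf
      simp
  · refine ⟨_, isChordedCycleLabelling_of_parametrization hn (fun z => residue n (A + (6 - z)))
      (fun z w h1 h2 => ?_) (fun z w => ?_) (Or.inr ?_)⟩
    · rw [residue_eq_iff_of_lt (by omega) (by omega)]
      omega
    · rw [hadd, hadd, residue_eq_iff, residue_eq_iff, residue_eq_iff, residue_eq_iff,
        or_comm, dvd_sub_comm, dvd_sub_comm (a := (n : ℤ)) (b := A + (6 - z))]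
      ring_nf
    · rw [hb (-2) h, hadd, hadd]
      ring_nf
      simp

end Relabelling
end LinearQuotients

theorem mainTheorem1 (K : Type*) [Field K] (n : ℕ) [NeZero n] (hn : 7 ≤ n) (a b : Fin n)
    (hab : ((a : ℕ) : ℤ) - ((b : ℕ) : ℤ) ≡ 2 [ZMOD (n : ℤ)] ∨
      ((a : ℕ) : ℤ) - ((b : ℕ) : ℤ) ≡ -2 [ZMOD (n : ℤ)]) :
    LinearQuotients.HasLinearQuotients
        (LinearQuotients.edgeIdeal K (LinearQuotients.modifiedAnticycle n a b) ^ 2) ∧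
      LinearQuotients.HasLinearQuotients
        (LinearQuotients.edgeIdeal K (LinearQuotients.modifiedAnticycle n a b) ^ 3) := by
  obtain ⟨v, hv⟩ := LinearQuotients.exists_isChordedCycleLabelling hn hab
  exact ⟨hv.hasLinearQuotients K hn le_rfl, hv.hasLinearQuotients K hn (by omega)⟩
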